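/- Let $\mathcal A$ be a unital $C^*$-algebra with centre $Z(\mathcal A)$, and let $H_{\mathcal A}=\ell^2(\mathcal A)$ be the standard right Hilbert $\mathcal A$-module: the sequences $x=(x_k)_{k\in\mathbb N}$ in $\mathcal A$ for which $\sum_k x_k^*x_k$ converges in norm, with inner product $\langle x,y\rangle=\sum_k x_k^*y_k$ and norm $\|x\|=\|\langle x,x\rangle\|^{1/2}$. Let $B^a(H_{\mathcal A})$ be the set of bounded adjointable $\mathcal A$-linear operators on $H_{\mathcal A}$. For $\alpha\in Z(\mathcal A)$ let $\alpha I\in B^a(H_{\mathcal A})$ be the operator $x\mapsto x\alpha$. Write $R(T)$ and $N(T)$ for the image and the kernel of $T$, and $\tilde\oplus$ for a direct sum of closed submodules that need not be orthogonal. A submodule is finitely generated if it is the linear span over $\mathcal A$ of a finite subset. Let $\widehat{\mathcal M\Phi}{}_-^+(H_{\mathcal A})$ be the set of all $T\in B^a(H_{\mathcal A})$ for which there are closed submodules $M_1,N_1,M_2,N_2,N$ of $H_{\mathcal A}$ such that - $H_{\mathcal A}=M_1\tilde\oplus N_1=M_2\tilde\oplus N_2$, the operator $T$ restricts to an isomorphism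 of $M_1$ onto $M_2$ (bounded, $\mathcal A$-linear, with bounded inverse), and $T(N_1)\subseteq N_2$; - $N_2$ is finitely generated; - $H_{\mathcal A}=M_1\tilde\oplus N\tilde\oplus N_2$, and the projection onto $M_1\tilde\oplus N$ along $N_2$ is adjointable. Let $P^a(H_{\mathcal A})$ be the set of all $P\in B^a(H_{\mathcal A})$ with $P^2=P$ (not necessarily orthogonal projections) such that $N(P)$ is finitely generated. For $D\in B^a(H_{\mathcal A})$ and $P\in P^a(H_{\mathcal A})$ put $$\sigma_{e\tilde d}^{\mathcal A}(D)=\{\alpha\in Z(\mathcal A) : D-\alpha I\notin\widehat{\mathcal M\Phi}{}_-^+(H_{\mathcal A})\},$$ $$\sigma_d^{\mathcal A}(PD|_{R(P)})=\{\alpha\in Z(\mathcal A) : (PD-\alpha I)|_{R(P)}\text{ is not onto }R(P)\}.$$ Theorem. For every $D\in B^a(H_{\mathcal A})$, $$\sigma_{e\tilde d}^{\mathcal A}(D)=\bigcap_{P\in P^a(H_{\mathcal A})}\sigma_d^{\mathcal A}(PD|_{R(P)}).$$ -/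

import Mathlib

open scoped MulOpposite

noncomputable section

namespace HilbertModule

/-! ### The standard module `H_A = ℓ²(A)` over a unital C⋆-algebra `A`

Elements are sequences `x : ℕ → A` such that `∑ₖ star (x k) * x k` converges in norm. It is a right
`A`-module, i.e. a module over `Aᵐᵒᵖ`, with `A`-valued inner product `⟪x, y⟫ = ∑ₖ star (x k) * y k`
and norm `‖x‖ = ‖⟪x, x⟫‖ ^ (1/2)`. -/

section StandardModule

variable {A : Type*} [CStarAlgebra A]

/-- The `ℓ²`-norm of the restriction of a sequence to a finite set of indices. -/
def finNorm (s : Finset ℕ) (x : ℕ → A) : ℝ := √‖∑ k ∈ s, star (x k) * x k‖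

theorem finNorm_nonneg (s : Finset ℕ) (x : ℕ → A) : 0 ≤ finNorm s x := Real.sqrt_nonneg _

theorem sq_finNorm (s : Finset ℕ) (x : ℕ → A) :
    finNorm s x ^ 2 = ‖∑ k ∈ s, star (x k) * x k‖ := Real.sq_sqrt (norm_nonneg _)

theorem norm_sum_star_mul_le (s : Finset ℕ) (x y : ℕ → A) :
    ‖∑ k ∈ s, star (x k) * y k‖ ≤ finNorm s x * finNorm s y := by
  let _ := CStarAlgebra.spectralOrder A
  have _ := CStarAlgebra.spectralOrderedRing A
  let _ : NormedAddCommGroup (WithCStarModule A (s → A)) := CStarModule.normedAddCommGroup A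
  let e : (ℕ → A) → WithCStarModule A (s → A) :=
    fun x => (WithCStarModule.equiv A (s → A)).symm fun k => star (x k)
  have hin : ∀ u v : ℕ → A, inner A (e u) (e v) = ∑ k ∈ s, star (v k) * u k := by
    intro u v
    rw [WithCStarModule.pi_inner, ← Finset.sum_coe_sort s]
    refine Finset.sum_congr rfl fun k _ => ?_
    rw [WithCStarModule.inner_def]
    simp [e]
  have hn : ∀ u : ℕ → A, √‖inner A (e u) (e u)‖ = finNorm s u := by
    intro u; rw [hin, finNorm]
  have h := CStarModule.norm_inner_le (A := A) (WithCStarModule A (s → A)) (x := e y) (y := e x)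
  rw [CStarModule.norm_eq_sqrt_norm_inner_self (A := A) (e x),
    CStarModule.norm_eq_sqrt_norm_inner_self (A := A) (e y), hn, hn, hin] at h
  linarith [mul_comm (finNorm s x) (finNorm s y)]

theorem finNorm_add_le (s : Finset ℕ) (x y : ℕ → A) :
    finNorm s (x + y) ≤ finNorm s x + finNorm s y := by
  have h : finNorm s (x + y) ^ 2 ≤ (finNorm s x + finNorm s y) ^ 2 := by
    have e : ∑ k ∈ s, star ((x + y) k) * (x + y) k
        = ∑ k ∈ s, star (x k) * x k + ∑ k ∈ s, star (x k) * y k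
          + (∑ k ∈ s, star (y k) * x k + ∑ k ∈ s, star (y k) * y k) := by
      rw [← Finset.sum_add_distrib, ← Finset.sum_add_distrib, ← Finset.sum_add_distrib]
      refine Finset.sum_congr rfl fun k _ => ?_
      simp only [Pi.add_apply, star_add]
      noncomm_ring
    rw [sq_finNorm, e]
    refine (norm_add_le _ _).trans ((add_le_add (norm_add_le _ _) (norm_add_le _ _)).trans ?_)
    have h1 := norm_sum_star_mul_le s x y
    have h2 := norm_sum_star_mul_le s y x
    rw [← sq_finNorm, ← sq_finNorm]
    nlinarith
  exact (sq_le_sq₀ (finNorm_nonneg _ _)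
    (add_nonneg (finNorm_nonneg _ _) (finNorm_nonneg _ _))).1 h

/-- `x` is square summable: the series `∑ₖ star (x k) * x k` converges in norm. -/
def IsSqSummable (x : ℕ → A) : Prop := Summable fun k => star (x k) * x k

theorem IsSqSummable.finNorm_lt {x : ℕ → A} (hx : IsSqSummable x) {ε : ℝ} (hε : 0 < ε) :
    ∃ s : Finset ℕ, ∀ t, Disjoint t s → finNorm t x < ε := by
  obtain ⟨s, hs⟩ := summable_iff_vanishing_norm.1 hx (ε ^ 2) (by positivity)
  refine ⟨s, fun t ht => ?_⟩
  have := hs t ht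
  rw [← sq_finNorm] at this
  exact (sq_lt_sq₀ (finNorm_nonneg _ _) hε.le).1 this

theorem IsSqSummable.summable_star_mul {x y : ℕ → A} (hx : IsSqSummable x) (hy : IsSqSummable y) :
    Summable fun k => star (x k) * y k := by
  refine summable_iff_vanishing_norm.2 fun ε hε => ?_
  obtain ⟨s, hs⟩ := hx.finNorm_lt one_pos
  obtain ⟨s', hs'⟩ := hy.finNorm_lt hε
  refine ⟨s ∪ s', fun t ht => (norm_sum_star_mul_le t x y).trans_lt ?_⟩
  rw [Finset.disjoint_union_right] at ht
  have h1 := hs t ht.1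
  have h2 := hs' t ht.2
  nlinarith [finNorm_nonneg t x, finNorm_nonneg t y]

theorem IsSqSummable.add {x y : ℕ → A} (hx : IsSqSummable x) (hy : IsSqSummable y) :
    IsSqSummable (x + y) := by
  have h := (Summable.add hx (hx.summable_star_mul hy)).add
    (Summable.add (hy.summable_star_mul hx) hy)
  refine h.congr fun k => ?_
  simp only [Pi.add_apply, star_add]
  noncomm_ring

theorem IsSqSummable.smul {x : ℕ → A} (a : Aᵐᵒᵖ) (hx : IsSqSummable x) :
    IsSqSummable (a • x) := by
  have h := (Summable.mul_left (star a.unop) hx).mul_right a.unop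
  refine h.congr fun k => ?_
  simp [MulOpposite.smul_eq_mul_unop, mul_assoc]

variable (A) in
/-- The square summable sequences, as a right `A`-submodule of all sequences. -/
def sqSummable : Submodule Aᵐᵒᵖ (ℕ → A) where
  carrier := {x | IsSqSummable x}
  add_mem' hx hy := IsSqSummable.add hx hy
  zero_mem' := by simp [IsSqSummable]
  smul_mem' a _ hx := IsSqSummable.smul a hx

variable (A) in
/-- The standard Hilbert module `H_A = ℓ²(A)`. (A separate type, so that it does not inherit the
topology of pointwise convergence from `ℕ → A`.) -/
def HA : Type _ := sqSummable A

instance : AddCommGroup (HA A) := inferInstanceAs (AddCommGroup (sqSummable A))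

/-- The right `A`-module structure `(x · a) k = x k * a`. -/
instance : Module Aᵐᵒᵖ (HA A) := inferInstanceAs (Module Aᵐᵒᵖ (sqSummable A))

instance : CoeFun (HA A) fun _ => ℕ → A := ⟨fun x => x.1⟩

theorem HA.isSqSummable (x : HA A) : IsSqSummable x := x.2

theorem HA.ext {x y : HA A} (h : ∀ k, x k = y k) : x = y := Subtype.ext (funext h)

theorem HA.add_apply (x y : HA A) (k : ℕ) : (x + y) k = x k + y k := rfl

theorem HA.smul_apply (a : Aᵐᵒᵖ) (x : HA A) (k : ℕ) : (a • x) k = x k * a.unop := rfl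

/-- The `A`-valued inner product `⟪x, y⟫ = ∑ₖ star (x k) * y k`. -/
instance : Inner A (HA A) := ⟨fun x y => ∑' k, star (x k) * y k⟩

theorem HA.hasSum_inner (x y : HA A) : HasSum (fun k => star (x k) * y k) (inner A x y) :=
  (x.isSqSummable.summable_star_mul y.isSqSummable).hasSum

theorem HA.tendsto_finNorm (x : HA A) :
    Filter.Tendsto (fun s => finNorm s x) Filter.atTop (nhds √‖inner A x x‖) :=
  (Real.continuous_sqrt.tendsto _).comp (x.hasSum_inner x).norm

/-- The norm `‖x‖ = ‖⟪x, x⟫‖ ^ (1/2)` of the Hilbert module `H_A`. -/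
instance : NormedAddCommGroup (HA A) :=
  AddGroupNorm.toNormedAddCommGroup
    { toFun := fun x => √‖inner A x x‖
      map_zero' := by
        have h : inner A (0 : HA A) 0 = 0 := by
          refine (HA.hasSum_inner (0 : HA A) 0).unique ?_
          have : (fun k => star ((0 : HA A) k) * (0 : HA A) k) = fun _ => 0 := by
            funext k; exact mul_zero _
          rw [this]; exact hasSum_zero
        rw [h]; simp
      add_le' := fun x y => le_of_tendsto_of_tendsto' (x + y).tendsto_finNorm
        (x.tendsto_finNorm.add y.tendsto_finNorm) fun s => finNorm_add_le s x y
      neg' := fun x => by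
        have h : inner A (-x) (-x) = inner A x x := by
          refine (HA.hasSum_inner (-x) (-x)).unique ((x.hasSum_inner x).congr_fun fun k => ?_)
          change star (-(x k)) * -(x k) = star (x k) * x k
          simp
        rw [h]
      eq_zero_of_map_eq_zero' := fun x hx => by
        let _ := CStarAlgebra.spectralOrder A
        have _ := CStarAlgebra.spectralOrderedRing A
        have h0 : inner A x x = 0 := by
          rwa [Real.sqrt_eq_zero (norm_nonneg _), norm_eq_zero] at hx
        refine HA.ext fun k => ?_
        have hk : star (x k) * x k ≤ inner A x x := by
          simpa using sum_le_hasSum {k} (fun j _ => star_mul_self_nonneg (x j)) (x.hasSum_inner x)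
        have : star (x k) * x k = 0 := le_antisymm (h0 ▸ hk) (star_mul_self_nonneg _)
        exact (CStarRing.star_mul_self_eq_zero_iff _).1 this }

theorem HA.norm_def (x : HA A) : ‖x‖ = √‖inner A x x‖ := rfl

theorem HA.norm_smul_le (a : Aᵐᵒᵖ) (x : HA A) : ‖a • x‖ ≤ ‖a.unop‖ * ‖x‖ := by
  have h : inner A (a • x) (a • x) = star a.unop * inner A x x * a.unop := by
    refine (HA.hasSum_inner (a • x) (a • x)).unique
      ((((x.hasSum_inner x).mul_left (star a.unop)).mul_right a.unop).congr_fun fun k => ?_)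
    rw [HA.smul_apply]
    simp [mul_assoc]
  rw [HA.norm_def, HA.norm_def, h]
  refine Real.sqrt_le_iff.2 ⟨by positivity, ?_⟩
  rw [mul_pow, Real.sq_sqrt (norm_nonneg _)]
  calc ‖star a.unop * inner A x x * a.unop‖
      ≤ ‖star a.unop‖ * ‖inner A x x‖ * ‖a.unop‖ := norm_mul₃_le
    _ = ‖a.unop‖ ^ 2 * ‖inner A x x‖ := by rw [norm_star]; ring

/-- An operator with an adjoint: `⟪T x, y⟫ = ⟪x, S y⟫` for some bounded `A`-linear `S`. Together
with the type of `T` (bounded `A`-linear maps), this describes `B^a(H_A)`. -/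
def IsAdjointable (T : HA A →L[Aᵐᵒᵖ] HA A) : Prop :=
  ∃ S : HA A →L[Aᵐᵒᵖ] HA A, ∀ x y, inner A (T x) y = inner A x (S y)

/-- For `α` in the centre `Z(A)`, the operator `α I : x ↦ x · α` on `H_A`. -/
def scalarOp (α : Subalgebra.center ℂ A) : HA A →L[Aᵐᵒᵖ] HA A where
  toFun x := MulOpposite.op (α : A) • x
  map_add' x y := smul_add _ x y
  map_smul' a x := by
    have h : MulOpposite.op (α : A) * a = a * MulOpposite.op (α : A) :=
      MulOpposite.unop_injective ((Subalgebra.mem_center_iff.1 α.2 a.unop))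
    change _ • a • x = a • _ • x
    rw [smul_smul, smul_smul, h]
  cont := AddMonoidHomClass.continuous_of_bound
    (DistribSMul.toAddMonoidHom (HA A) (MulOpposite.op (α : A))) ‖(α : A)‖ fun x =>
      HA.norm_smul_le _ x

end StandardModule

section Spectra

variable {A : Type*} [CStarAlgebra A]

/-- The class `\widehat{MΦ}_-^+(H_A)`: adjointable `D` for which there are closed submodules with
`H_A = M₁ ⊕ N₁` and `H_A = M₂ ⊕ N₂` (direct sums need not be orthogonal) such that `D` maps `M₁`
isomorphically onto `M₂` and maps `N₁` into `N₂` (its matrix is `diag(D₁, D₄)` with `D₁` an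
isomorphism), `N₂` is finitely generated, and `H_A = M₁ ⊕ N ⊕ N₂` for some closed submodule `N`
such that the projection `P` onto `M₁ ⊕ N` along `N₂` is adjointable. -/
def MPhiHatMinusPlus (D : HA A →L[Aᵐᵒᵖ] HA A) : Prop :=
  IsAdjointable D ∧
  ∃ M₁ N₁ M₂ N₂ N : Submodule Aᵐᵒᵖ (HA A),
    IsClosed (M₁ : Set (HA A)) ∧ IsClosed (N₁ : Set (HA A)) ∧
    IsClosed (M₂ : Set (HA A)) ∧ IsClosed (N₂ : Set (HA A)) ∧ IsClosed (N : Set (HA A)) ∧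
    IsCompl M₁ N₁ ∧ IsCompl M₂ N₂ ∧
    (∃ D₁ : M₁ ≃L[Aᵐᵒᵖ] M₂, ∀ x : M₁, (D₁ x : HA A) = D x) ∧
    (∀ x ∈ N₁, D x ∈ N₂) ∧
    N₂.FG ∧
    Disjoint M₁ N ∧ IsCompl (M₁ ⊔ N) N₂ ∧
    ∃ P : HA A →L[Aᵐᵒᵖ] HA A, IsAdjointable P ∧
      (∀ x ∈ M₁ ⊔ N, P x = x) ∧ (∀ x ∈ N₂, P x = 0)

variable (A) in
/-- `P^a(H_A)`: the bounded adjointable (possibly skew) projections on `H_A` whose kernel is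
finitely generated. -/
def adjointableProjections : Set (HA A →L[Aᵐᵒᵖ] HA A) :=
  {P | IsAdjointable P ∧ IsIdempotentElem P ∧ P.ker.FG}

/-- The spectrum of all `α` in the centre with `D - α I` outside `\widehat{MΦ}_-^+(H_A)`. -/
def essentialDefectSpectrum (D : HA A →L[Aᵐᵒᵖ] HA A) : Set (Subalgebra.center ℂ A) :=
  {α | ¬ MPhiHatMinusPlus (D - scalarOp α)}

/-- The spectrum of all `α` in the centre such that the restriction of `P D - α I` to the range
`R(P)` is not onto `R(P)`. -/
def compressionDefectSpectrum (P D : HA A →L[Aᵐᵒᵖ] HA A) : Set (Subalgebra.center ℂ A) :=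
  {α | P.range.map (P ∘L D - scalarOp α : HA A →L[Aᵐᵒᵖ] HA A).toLinearMap ≠ P.range}

end Spectra

end HilbertModule

end

/-!
Write `T = D - α I`. As a projection `P` commutes with `α I`, the point `α` lies outside
`σ_d(P D|_{R(P)})` exactly when `P T` maps `R(P)` onto `R(P)`
(`notMem_compressionDefectSpectrum_iff`). The theorem therefore says that `T` belongs to
`MPhiHatMinusPlus` if and only if some `P` in `adjointableProjections` has this property.

If `T` belongs to the class, the projection onto `M₁ ⊕ N` along `N₂` is such a `P`, because
`P T M₁ = P M₂ = R(P)` (`MPhiHatMinusPlus.exists_surjective`).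

Conversely, suppose that `P T` maps `R(P)` onto `R(P)`. Then `P T P + (1 - P)` is adjointable and
onto, and a surjective adjointable operator `S` has the bounded `A`-linear right inverse
`S* (S S*)⁻¹` (`IsAdjointable.exists_rightInverse`). This gives a bounded `G` with `P T G = P` and
`P G = G = G P`; the ranges and kernels of the idempotents `G T`, `T G` and `P` are the submodules
required (`mPhiHatMinusPlus_of_surjective`).

The right inverse rests on the completeness of `ℓ²(A)`: by the open mapping theorem `S*` is bounded
below, hence so are all the operators `S S* + t` with `t ≥ 0`, by one and the same constant. They are
invertible for large `t`, and the method of continuity carries invertibility down to `t = 0`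
(`surjective_of_add_smul_bounded_below`).
-/

namespace HilbertModule

variable {A : Type*} [CStarAlgebra A]

/-! ### The inner product and completeness of `ℓ²(A)` -/

theorem HA.inner_add_right (x y z : HA A) :
    inner A x (y + z) = inner A x y + inner A x z := by
  refine (x.hasSum_inner (y + z)).unique
    (((x.hasSum_inner y).add (x.hasSum_inner z)).congr_fun fun k => ?_)
  rw [HA.add_apply, mul_add]

theorem HA.star_inner (x y : HA A) : star (inner A x y) = inner A y x := by
  refine HasSum.unique ((x.hasSum_inner y).star.congr_fun fun k => ?_) (y.hasSum_inner x)
  simp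

theorem HA.inner_add_left (x y z : HA A) :
    inner A (x + y) z = inner A x z + inner A y z := by
  rw [← HA.star_inner, HA.inner_add_right, star_add, HA.star_inner, HA.star_inner]

theorem HA.inner_smul_right (x y : HA A) (a : Aᵐᵒᵖ) :
    inner A x (a • y) = inner A x y * a.unop := by
  refine (x.hasSum_inner (a • y)).unique
    (((x.hasSum_inner y).mul_right a.unop).congr_fun fun k => ?_)
  rw [HA.smul_apply, mul_assoc]

theorem HA.inner_smul_left (x y : HA A) (a : Aᵐᵒᵖ) :
    inner A (a • x) y = star a.unop * inner A x y := by
  rw [← HA.star_inner, HA.inner_smul_right, star_mul, HA.star_inner]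

theorem HA.inner_neg_right (x y : HA A) : inner A x (-y) = -inner A x y := by
  simpa using HA.inner_smul_right x y (-1)

theorem HA.inner_neg_left (x y : HA A) : inner A (-x) y = -inner A x y := by
  simpa using HA.inner_smul_left x y (-1)

theorem HA.sq_norm (x : HA A) : ‖x‖ ^ 2 = ‖(inner A x x : A)‖ :=
  Real.sq_sqrt (norm_nonneg _)

/-- The Cauchy–Schwarz inequality in `ℓ²(A)`. -/
theorem HA.norm_inner_le (x y : HA A) : ‖(inner A x y : A)‖ ≤ ‖x‖ * ‖y‖ :=
  le_of_tendsto_of_tendsto' (x.hasSum_inner y).norm (x.tendsto_finNorm.mul y.tendsto_finNorm)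
    fun s => norm_sum_star_mul_le s x y

theorem HA.finNorm_le_norm (x : HA A) (s : Finset ℕ) : finNorm s x ≤ ‖x‖ := by
  let _ := CStarAlgebra.spectralOrder A
  have _ := CStarAlgebra.spectralOrderedRing A
  refine Real.sqrt_le_sqrt (CStarAlgebra.norm_le_norm_of_nonneg_of_le
    (Finset.sum_nonneg fun k _ => star_mul_self_nonneg _) ?_)
  exact sum_le_hasSum s (fun j _ => star_mul_self_nonneg (x j)) (x.hasSum_inner x)

theorem HA.norm_apply_le (x : HA A) (k : ℕ) : ‖x k‖ ≤ ‖x‖ := by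
  simpa [finNorm, CStarRing.norm_star_mul_self, Real.sqrt_mul_self] using x.finNorm_le_norm {k}

theorem continuous_finNorm (s : Finset ℕ) : Continuous (finNorm s : (ℕ → A) → ℝ) := by
  unfold finNorm
  fun_prop

instance : CompleteSpace (HA A) := by
  refine Metric.complete_of_cauchySeq_tendsto fun u hu => ?_
  have hcoord : ∀ k, CauchySeq fun n => u n k := fun k => by
    refine Metric.cauchySeq_iff'.2 fun ε hε => ?_
    obtain ⟨N, hN⟩ := Metric.cauchySeq_iff'.1 hu ε hε
    refine ⟨N, fun n hn => lt_of_le_of_lt ?_ (hN n hn)⟩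
    rw [dist_eq_norm, dist_eq_norm]
    exact (u n - u N).norm_apply_le k
  choose x hx using fun k => cauchySeq_tendsto_of_complete (hcoord k)
  have hlim : Filter.Tendsto (fun n => (u n : ℕ → A)) Filter.atTop (nhds x) :=
    tendsto_pi_nhds.2 hx
  -- Estimates on finite sets of indices are uniform, hence survive the coordinatewise limit.
  have hfin : ∀ ε > 0, ∃ N, ∀ n ≥ N, ∀ s, finNorm s ((u n : ℕ → A) - x) ≤ ε := fun ε hε => by
    obtain ⟨N, hN⟩ := Metric.cauchySeq_iff.1 hu ε hε
    refine ⟨N, fun n hn s => ?_⟩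
    refine le_of_tendsto (((continuous_finNorm s).tendsto _).comp (hlim.const_sub (u n : ℕ → A))) ?_
    filter_upwards [Filter.eventually_ge_atTop N] with m hm
    have := hN n hn m hm
    rw [dist_eq_norm] at this
    exact ((u n - u m).finNorm_le_norm s).trans this.le
  have hneg : ∀ s (y : ℕ → A), finNorm s (-y) = finNorm s y := fun s y => by simp [finNorm]
  have hxs : x ∈ sqSummable A := by
    refine summable_iff_vanishing_norm.2 fun ε hε => ?_
    obtain ⟨N, hN⟩ := hfin (√ε / 3) (by positivity)
    obtain ⟨s, hs⟩ := (u N).isSqSummable.finNorm_lt (ε := √ε / 3) (by positivity)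
    refine ⟨s, fun t ht => ?_⟩
    have h1 := hs t ht
    have h2 := hN N le_rfl t
    have h3 := finNorm_add_le t (u N : ℕ → A) (-((u N : ℕ → A) - x))
    rw [hneg, show (u N : ℕ → A) + -((u N : ℕ → A) - x) = x by abel] at h3
    have h4 : finNorm t x < √ε := by linarith [Real.sqrt_pos.2 hε]
    exact (Real.sqrt_lt_sqrt_iff (norm_nonneg _)).1 h4
  let v : HA A := ⟨x, hxs⟩
  refine ⟨v, Metric.tendsto_atTop.2 fun ε hε => ?_⟩
  obtain ⟨N, hN⟩ := hfin (ε / 2) (by positivity)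
  refine ⟨N, fun n hn => ?_⟩
  rw [dist_eq_norm]
  refine lt_of_le_of_lt ?_ (half_lt_self hε)
  exact le_of_tendsto' (u n - v).tendsto_finNorm fun s => hN n hn s

/-! ### The complex Banach space structure -/

/-- Complex scalars act on `ℓ²(A)` through `ℂ → Aᵐᵒᵖ`. -/
instance : Module ℂ (HA A) := Module.compHom (HA A) (algebraMap ℂ Aᵐᵒᵖ)

theorem HA.complex_smul_def (c : ℂ) (x : HA A) : c • x = algebraMap ℂ Aᵐᵒᵖ c • x := rfl

instance : IsScalarTower ℂ Aᵐᵒᵖ (HA A) where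
  smul_assoc c a x := by
    rw [HA.complex_smul_def, smul_smul, Algebra.smul_def]

instance : NormedSpace ℂ (HA A) where
  norm_smul_le c x := by
    rw [HA.complex_smul_def]
    refine (HA.norm_smul_le _ _).trans (mul_le_mul_of_nonneg_right ?_ (norm_nonneg _))
    change ‖algebraMap ℂ A c‖ ≤ ‖c‖
    rcases subsingleton_or_nontrivial A with h | h
    · rw [Subsingleton.elim (algebraMap ℂ A c) 0, norm_zero]
      exact norm_nonneg c
    · rw [norm_algebraMap']

theorem HA.inner_complex_smul_right (x y : HA A) (c : ℂ) :
    inner A x (c • y) = c • (inner A x y : A) := by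
  rw [HA.complex_smul_def, HA.inner_smul_right, MulOpposite.algebraMap_apply,
    MulOpposite.unop_op, ← Algebra.commutes, Algebra.smul_def]

/-! ### Right inverses of surjective adjointable operators -/

/-- Method of continuity: an operator `T` for which all `T + t`, `t ≥ 0`, are bounded below by the
same constant is surjective. Invertibility holds for large `t`, and passes from `t + δ` to `t`
when `δ` is smaller than that constant. -/
theorem surjective_of_add_smul_bounded_below {E : Type*} [NormedAddCommGroup E] [NormedSpace ℂ E]
    [CompleteSpace E] (T : E →L[ℂ] E) {c : ℝ} (hc : 0 < c)
    (h : ∀ t : ℝ, 0 ≤ t → ∀ x, c * ‖x‖ ≤ ‖T x + (t : ℂ) • x‖) : Function.Surjective T := by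
  have step : ∀ n : ℕ, IsUnit (T + ((n * (c / 2) : ℝ) : ℂ) • (1 : E →L[ℂ] E)) → IsUnit T := by
    intro n
    induction n with
    | zero => intro hu; simpa using hu
    | succ n ih =>
      rintro ⟨u, hu⟩
      refine ih ?_
      have hinv : ‖(↑u⁻¹ : E →L[ℂ] E)‖ ≤ c⁻¹ := by
        refine ContinuousLinearMap.opNorm_le_bound _ (by positivity) fun x => ?_
        have h1 := h (((n + 1 : ℕ) : ℝ) * (c / 2)) (by positivity) ((↑u⁻¹ : E →L[ℂ] E) x)
        have h2 : (u : E →L[ℂ] E) ((↑u⁻¹ : E →L[ℂ] E) x) = x :=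
          DFunLike.congr_fun u.mul_inv x
        rw [hu] at h2
        simp only [add_apply, smul_apply, one_apply_eq_self] at h2
        rw [h2] at h1
        rw [inv_mul_eq_div, le_div_iff₀ hc]
        linarith
      have e : T + ((n * (c / 2) : ℝ) : ℂ) • (1 : E →L[ℂ] E)
          = u * (1 - ((c / 2 : ℝ) : ℂ) • (↑u⁻¹ : E →L[ℂ] E)) := by
        rw [mul_sub, mul_one, mul_smul_comm, u.mul_inv, hu, add_sub_assoc, ← sub_smul]
        congr 2
        push_cast
        ring
      rw [e]
      refine u.isUnit.mul (isUnit_one_sub_of_norm_lt_one ?_)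
      rw [norm_smul, Complex.norm_real, Real.norm_of_nonneg (by positivity)]
      calc c / 2 * ‖(↑u⁻¹ : E →L[ℂ] E)‖ ≤ c / 2 * c⁻¹ := by gcongr
        _ < 1 := by field_simp; norm_num
  obtain ⟨n, hn⟩ := exists_nat_gt (‖T‖ / (c / 2))
  have hpos : 0 < n * (c / 2) := (norm_nonneg T).trans_lt ((div_lt_iff₀ (by positivity)).1 hn)
  have hlt : ‖T‖ < n * (c / 2) := (div_lt_iff₀ (by positivity)).1 hn
  have hne : ((n * (c / 2) : ℝ) : ℂ) ≠ 0 := by exact_mod_cast hpos.ne'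
  have hT : IsUnit T := by
    refine step n ?_
    have e : T + ((n * (c / 2) : ℝ) : ℂ) • (1 : E →L[ℂ] E)
        = Units.mk0 _ hne • (1 - -(((n * (c / 2) : ℝ) : ℂ)⁻¹ • T)) := by
      rw [Units.smul_mk0, sub_neg_eq_add, smul_add, smul_inv_smul₀ hne, add_comm]
    rw [e]
    refine IsUnit.smul _ (isUnit_one_sub_of_norm_lt_one ?_)
    rw [norm_neg, norm_smul, norm_inv, Complex.norm_real, Real.norm_of_nonneg hpos.le,
      inv_mul_lt_iff₀ hpos, mul_one]
    exact hlt
  obtain ⟨u, rfl⟩ := hT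
  exact fun y => ⟨(↑u⁻¹ : E →L[ℂ] E) y, DFunLike.congr_fun u.mul_inv y⟩

/-- The adjoint of a surjective operator is bounded below, by the open mapping theorem. -/
theorem exists_adjoint_bounded_below {S S' : HA A →L[Aᵐᵒᵖ] HA A}
    (hS : ∀ x y, inner A (S x) y = (inner A x (S' y) : A)) (hsurj : Function.Surjective S) :
    ∃ C > 0, ∀ y, ‖y‖ ≤ C * ‖S' y‖ := by
  obtain ⟨C, hC, h⟩ := (S.restrictScalars ℂ).exists_preimage_norm_le hsurj
  refine ⟨C, hC, fun y => ?_⟩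
  obtain ⟨x, hx, hxy⟩ := h y
  replace hx : S x = y := hx
  have h1 : ‖y‖ ^ 2 ≤ ‖x‖ * ‖S' y‖ := by
    rw [HA.sq_norm]
    nth_rw 1 [← hx]
    rw [hS]
    exact HA.norm_inner_le _ _
  rcases (norm_nonneg y).eq_or_lt with h0 | h0
  · rw [← h0]
    positivity
  · refine le_of_mul_le_mul_left ?_ h0
    nlinarith [norm_nonneg (S' y)]

/-- A surjective adjointable operator `S` on `ℓ²(A)` has the bounded `A`-linear right inverse
`S* (S S*)⁻¹`. -/
theorem IsAdjointable.exists_rightInverse {S : HA A →L[Aᵐᵒᵖ] HA A} (hS : IsAdjointable S)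
    (hsurj : Function.Surjective S) : ∃ R : HA A →L[Aᵐᵒᵖ] HA A, ∀ y, S (R y) = y := by
  let _ := CStarAlgebra.spectralOrder A
  have _ := CStarAlgebra.spectralOrderedRing A
  obtain ⟨S', hS'⟩ := hS
  obtain ⟨C, hC, hbd⟩ := exists_adjoint_bounded_below hS' hsurj
  have hpos : ∀ x : HA A, 0 ≤ (inner A x x : A) := fun x =>
    (x.hasSum_inner x).nonneg fun k => star_mul_self_nonneg (x k)
  have hlow : ∀ t : ℝ, 0 ≤ t → ∀ x, (C ^ 2)⁻¹ * ‖x‖ ≤ ‖S (S' x) + (t : ℂ) • x‖ := by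
    intro t ht x
    have e : (inner A x (S (S' x) + (t : ℂ) • x) : A)
        = inner A (S' x) (S' x) + (t : ℂ) • inner A x x := by
      rw [HA.inner_add_right, HA.inner_complex_smul_right, ← HA.star_inner (S (S' x)), hS',
        HA.star_inner]
    have h1 : ‖S' x‖ ^ 2 ≤ ‖x‖ * ‖S (S' x) + (t : ℂ) • x‖ := by
      refine le_trans ?_ (HA.norm_inner_le _ _)
      rw [e, HA.sq_norm]
      refine CStarAlgebra.norm_le_norm_of_nonneg_of_le (hpos _) (le_add_of_nonneg_right ?_)
      rw [Complex.coe_smul]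
      exact smul_nonneg ht (hpos x)
    have h2 : ‖x‖ ^ 2 ≤ C ^ 2 * ‖S' x‖ ^ 2 := by
      rw [← mul_pow]
      exact pow_le_pow_left₀ (norm_nonneg _) (hbd x) 2
    rw [inv_mul_le_iff₀ (by positivity)]
    rcases (norm_nonneg x).eq_or_lt with h0 | h0
    · rw [← h0]
      positivity
    · refine le_of_mul_le_mul_left ?_ h0
      nlinarith [mul_le_mul_of_nonneg_left h1 (sq_nonneg C)]
  let T : HA A →L[Aᵐᵒᵖ] HA A := S ∘L S'
  have hTsurj : Function.Surjective T :=
    surjective_of_add_smul_bounded_below (T.restrictScalars ℂ) (by positivity) hlow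
  have hTlow : ∀ x, ‖x‖ ≤ C ^ 2 * ‖T x‖ := fun x => by
    have h := hlow 0 le_rfl x
    rwa [Complex.ofReal_zero, zero_smul, add_zero, inv_mul_le_iff₀ (by positivity)] at h
  have hTinj : Function.Injective T := by
    refine (injective_iff_map_eq_zero T).2 fun x hx => ?_
    simpa [hx] using hTlow x
  let e := LinearEquiv.ofBijective T.toLinearMap ⟨hTinj, hTsurj⟩
  have he : ∀ y, T (e.symm y) = y := fun y => e.apply_symm_apply y
  let R : HA A →L[Aᵐᵒᵖ] HA A :=
    { e.symm.toLinearMap with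
      cont := AddMonoidHomClass.continuous_of_bound e.symm (C ^ 2) fun y => by
        simpa only [he] using hTlow (e.symm y) }
  exact ⟨S' ∘L R, he⟩

/-! ### Operations on adjointable operators -/

theorem IsAdjointable.id : IsAdjointable (ContinuousLinearMap.id Aᵐᵒᵖ (HA A)) :=
  ⟨ContinuousLinearMap.id Aᵐᵒᵖ (HA A), fun _ _ => rfl⟩

theorem IsAdjointable.add {S T : HA A →L[Aᵐᵒᵖ] HA A} (hS : IsAdjointable S)
    (hT : IsAdjointable T) : IsAdjointable (S + T) := by
  obtain ⟨S', hS⟩ := hS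
  obtain ⟨T', hT⟩ := hT
  exact ⟨S' + T', fun x y => by
    rw [add_apply, add_apply, HA.inner_add_left, HA.inner_add_right, hS, hT]⟩

theorem IsAdjointable.neg {T : HA A →L[Aᵐᵒᵖ] HA A} (hT : IsAdjointable T) :
    IsAdjointable (-T) := by
  obtain ⟨T', hT⟩ := hT
  exact ⟨-T', fun x y => by
    rw [neg_apply, neg_apply, HA.inner_neg_left, HA.inner_neg_right, hT]⟩

theorem IsAdjointable.sub {S T : HA A →L[Aᵐᵒᵖ] HA A} (hS : IsAdjointable S)
    (hT : IsAdjointable T) : IsAdjointable (S - T) := by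
  rw [sub_eq_add_neg]
  exact hS.add hT.neg

theorem IsAdjointable.comp {S T : HA A →L[Aᵐᵒᵖ] HA A} (hS : IsAdjointable S)
    (hT : IsAdjointable T) : IsAdjointable (S ∘L T) := by
  obtain ⟨S', hS⟩ := hS
  obtain ⟨T', hT⟩ := hT
  exact ⟨T' ∘L S', fun x y => (hS _ _).trans (hT _ _)⟩

/-- The adjoint of `α I` is `star α I`. -/
theorem IsAdjointable.scalarOp (α : Subalgebra.center ℂ A) : IsAdjointable (scalarOp α) := by
  have hα : star (α : A) ∈ Subalgebra.center ℂ A := Subalgebra.mem_center_iff.2 fun b => by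
    have h := congrArg star (Subalgebra.mem_center_iff.1 α.2 (star b))
    simpa using h.symm
  refine ⟨HilbertModule.scalarOp ⟨star (α : A), hα⟩, fun x y => ?_⟩
  change inner A (MulOpposite.op (α : A) • x) y = inner A x (MulOpposite.op (star (α : A)) • y)
  rw [HA.inner_smul_left, HA.inner_smul_right]
  exact (Subalgebra.mem_center_iff.1 hα _).symm

/-! ### Surjective compressions and the class `MPhiHatMinusPlus` -/

theorem mem_ker_id_sub {Q : HA A →L[Aᵐᵒᵖ] HA A} {x : HA A} :
    x ∈ (ContinuousLinearMap.id Aᵐᵒᵖ (HA A) - Q).ker ↔ Q x = x :=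
  (sub_eq_zero (a := x) (b := Q x)).trans eq_comm

/-- An idempotent splits the module into its fixed points and its kernel. -/
theorem isCompl_ker_id_sub_ker {Q : HA A →L[Aᵐᵒᵖ] HA A} (hQ : ∀ x, Q (Q x) = Q x) :
    IsCompl (ContinuousLinearMap.id Aᵐᵒᵖ (HA A) - Q).ker Q.ker := by
  constructor
  · refine Submodule.disjoint_def.2 fun x h1 h2 => ?_
    rw [← mem_ker_id_sub.1 h1]
    exact h2
  · refine codisjoint_iff.2 (eq_top_iff.2 fun x _ => ?_)
    refine Submodule.mem_sup.2 ⟨Q x, mem_ker_id_sub.2 (hQ x), x - Q x, ?_, add_sub_cancel _ _⟩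
    change Q (x - Q x) = 0
    rw [map_sub, hQ, sub_self]

/-- If the compression of an adjointable `T` to the range of an adjointable idempotent `P` is onto,
then `P` has a factorization through `T` on the right: `P T G = P` with `P G = G = G P`. The operator
`P T P + (1 - P)` is onto, so it has a right inverse `R`, and `G = R P`. -/
theorem exists_right_factor {P T : HA A →L[Aᵐᵒᵖ] HA A} (hPa : IsAdjointable P)
    (hP : ∀ x, P (P x) = P x) (hT : IsAdjointable T)
    (hsurj : ∀ y, ∃ x, P (T (P x)) = P y) :
    ∃ G : HA A →L[Aᵐᵒᵖ] HA A, (∀ y, P (T (G y)) = P y) ∧ (∀ y, P (G y) = G y) ∧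
      ∀ y, G (P y) = G y := by
  let S : HA A →L[Aᵐᵒᵖ] HA A := P ∘L T ∘L P + (ContinuousLinearMap.id Aᵐᵒᵖ (HA A) - P)
  have hSx : ∀ x, S x = P (T (P x)) + (x - P x) := fun x => rfl
  have hS : IsAdjointable S := (hPa.comp (hT.comp hPa)).add (IsAdjointable.id.sub hPa)
  obtain ⟨R, hR⟩ := hS.exists_rightInverse fun y => by
    obtain ⟨x, hx⟩ := hsurj y
    refine ⟨P x + (y - P y), ?_⟩
    have e : P (P x + (y - P y)) = P x := by rw [map_add, map_sub, hP, hP, sub_self, add_zero]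
    rw [hSx, e, hx]
    abel
  have h1 : ∀ y, P (T (P (R (P y)))) = P y := fun y => by
    have h := congrArg P (hR (P y))
    rwa [hSx, map_add, map_sub, hP, hP, hP, sub_self, add_zero] at h
  have h2 : ∀ y, P (R (P y)) = R (P y) := fun y => by
    have h := hR (P y)
    rw [hSx, h1, add_eq_left, sub_eq_zero] at h
    exact h.symm
  refine ⟨R ∘L P, fun y => ?_, h2, fun y => congrArg R (hP y)⟩
  have h := h1 y
  rwa [h2] at h

/-- With `G` as in `exists_right_factor`, `G T` and `T G` are idempotents, `T` and `G` are inverse to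
each other between their ranges `M₁` and `M₂`, and `T G` has the same kernel `N₂` as `P`. The
remaining submodules are `N₁ = N(G T) = N(P T)` and `N = R(P) ∩ N₁`. -/
theorem mPhiHatMinusPlus_of_surjective {P T : HA A →L[Aᵐᵒᵖ] HA A} (hPa : IsAdjointable P)
    (hP : ∀ x, P (P x) = P x) (hfg : P.ker.FG) (hT : IsAdjointable T)
    (hsurj : ∀ y, ∃ x, P (T (P x)) = P y) : MPhiHatMinusPlus T := by
  obtain ⟨G, hG, hPG, hGP⟩ := exists_right_factor hPa hP hT hsurj
  have hGTG : ∀ y, G (T (G y)) = G y := fun y => by rw [← hGP, hG, hGP]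
  let E : HA A →L[Aᵐᵒᵖ] HA A := G ∘L T
  let F : HA A →L[Aᵐᵒᵖ] HA A := T ∘L G
  let I := ContinuousLinearMap.id Aᵐᵒᵖ (HA A)
  have hE : ∀ x, E (E x) = E x := fun x => hGTG (T x)
  have hF : ∀ x, F (F x) = F x := fun x => congrArg T (hGTG x)
  have hPE : ∀ x, P (E x) = E x := fun x => hPG (T x)
  have hFP : F.ker = P.ker := by
    ext y
    change T (G y) = 0 ↔ P y = 0
    constructor
    · intro h
      rw [← hG, h, map_zero]
    · intro h
      rw [← hGP, h, map_zero, map_zero]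
  have hsup : (I - E).ker ⊔ ((I - P).ker ⊓ E.ker) = (I - P).ker := by
    refine le_antisymm (sup_le (fun x hx => ?_) inf_le_left) fun x hx => ?_
    · rw [← mem_ker_id_sub.1 hx]
      exact mem_ker_id_sub.2 (hPE x)
    · refine Submodule.mem_sup.2 ⟨E x, mem_ker_id_sub.2 (hE x), x - E x,
        ⟨mem_ker_id_sub.2 ?_, ?_⟩, add_sub_cancel _ _⟩
      · rw [map_sub, hPE, mem_ker_id_sub.1 hx]
      · change E (x - E x) = 0
        rw [map_sub, hE, sub_self]
  let D₁ : (I - E).ker ≃L[Aᵐᵒᵖ] (I - F).ker :=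
    ContinuousLinearEquiv.equivOfInverse
      ((T ∘L (I - E).ker.subtypeL).codRestrict _ fun x =>
        mem_ker_id_sub.2 (congrArg T (mem_ker_id_sub.1 x.2)))
      ((G ∘L (I - F).ker.subtypeL).codRestrict _ fun y =>
        mem_ker_id_sub.2 (congrArg G (mem_ker_id_sub.1 y.2)))
      (fun x => Subtype.ext (mem_ker_id_sub.1 x.2))
      (fun y => Subtype.ext (mem_ker_id_sub.1 y.2))
  refine ⟨hT, (I - E).ker, E.ker, (I - F).ker, P.ker, (I - P).ker ⊓ E.ker,
    (I - E).isClosed_ker, E.isClosed_ker, (I - F).isClosed_ker, P.isClosed_ker,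
    (I - P).isClosed_ker.inter E.isClosed_ker, isCompl_ker_id_sub_ker hE,
    hFP ▸ isCompl_ker_id_sub_ker hF, ⟨D₁, fun _ => rfl⟩, fun x hx => ?_, hfg,
    (isCompl_ker_id_sub_ker hE).disjoint.mono_right inf_le_right, ?_, P, hPa, ?_,
    fun x hx => hx⟩
  · change G (T x) = 0 at hx
    change P (T x) = 0
    rw [← hG, hx, map_zero, map_zero]
  · rw [hsup]
    exact isCompl_ker_id_sub_ker hP
  · rw [hsup]
    exact fun x hx => mem_ker_id_sub.1 hx

/-- The required `P` is the projection onto `M₁ ⊕ N` along `N₂`: `P T` maps `M₁ ⊆ R(P)` onto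
`P(M₂) = P(M₂ + N₂) = R(P)`. -/
theorem MPhiHatMinusPlus.exists_surjective {T : HA A →L[Aᵐᵒᵖ] HA A} (h : MPhiHatMinusPlus T) :
    ∃ P ∈ adjointableProjections A, ∀ y, ∃ x, P (T (P x)) = P y := by
  obtain ⟨-, M₁, N₁, M₂, N₂, N, -, -, -, -, -, -, hc₂, ⟨D₁, hD₁⟩, -, hfg, -, hc, P, hPa, hP₁,
    hP₀⟩ := h
  have hdec : ∀ x, P x ∈ M₁ ⊔ N ∧ x - P x ∈ N₂ := fun x => by
    obtain ⟨u, hu, v, hv, rfl⟩ := Submodule.mem_sup.1 (hc.sup_eq_top ▸ Submodule.mem_top (x := x))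
    rw [map_add, hP₁ u hu, hP₀ v hv, add_zero, add_sub_cancel_left]
    exact ⟨hu, hv⟩
  have hker : P.ker = N₂ := le_antisymm
    (fun x hx => by simpa [show P x = 0 from hx] using (hdec x).2) hP₀
  refine ⟨P, ⟨hPa, ContinuousLinearMap.ext fun x => hP₁ _ (hdec x).1, hker ▸ hfg⟩, fun y => ?_⟩
  obtain ⟨u, hu, v, hv, rfl⟩ := Submodule.mem_sup.1 (hc₂.sup_eq_top ▸ Submodule.mem_top (x := y))
  refine ⟨D₁.symm ⟨u, hu⟩, ?_⟩
  rw [hP₁ _ (Submodule.mem_sup_left (D₁.symm ⟨u, hu⟩).2), ← hD₁, D₁.apply_symm_apply, map_add,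
    hP₀ v hv, add_zero]

/-- As `P` commutes with `α I`, the operator `P D - α I` agrees with `P (D - α I)` on `R(P)`. -/
theorem notMem_compressionDefectSpectrum_iff {P D : HA A →L[Aᵐᵒᵖ] HA A}
    (hP : ∀ x, P (P x) = P x) (α : Subalgebra.center ℂ A) :
    α ∉ compressionDefectSpectrum P D ↔ ∀ y, ∃ x, P ((D - scalarOp α) (P x)) = P y := by
  have e : ∀ x, (P ∘L D - scalarOp α) (P x) = P ((D - scalarOp α) (P x)) := fun x => by
    change P (D (P x)) - MulOpposite.op (α : A) • P x
      = P (D (P x) - MulOpposite.op (α : A) • P x)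
    rw [map_sub, map_smul, hP]
  rw [compressionDefectSpectrum, Set.mem_ofPred_eq, not_not]
  constructor
  · intro h y
    have hy : P y ∈ P.range := ⟨y, rfl⟩
    rw [← h] at hy
    obtain ⟨_, ⟨x, rfl⟩, hx⟩ := hy
    exact ⟨x, (e x).symm.trans hx⟩
  · intro h
    apply le_antisymm
    · rintro _ ⟨_, ⟨x, rfl⟩, rfl⟩
      exact ⟨_, (e x).symm⟩
    · rintro _ ⟨y, rfl⟩
      obtain ⟨x, hx⟩ := h y
      exact ⟨P x, ⟨x, rfl⟩, (e x).trans hx⟩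

end HilbertModule

theorem theorem3p8 {A : Type*} [CStarAlgebra A]
    (D : HilbertModule.HA A →L[Aᵐᵒᵖ] HilbertModule.HA A)
    (hD : HilbertModule.IsAdjointable D) :
    HilbertModule.essentialDefectSpectrum D =
      ⋂ P ∈ HilbertModule.adjointableProjections A,
        HilbertModule.compressionDefectSpectrum P D := by
  ext α
  rw [Set.mem_iInter₂, ← not_iff_not]
  push Not
  rw [HilbertModule.essentialDefectSpectrum, Set.mem_ofPred_eq, not_not]
  constructor
  · intro h
    obtain ⟨P, hP, hsurj⟩ := h.exists_surjective
    exact ⟨P, hP, (HilbertModule.notMem_compressionDefectSpectrum_iff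
      (DFunLike.congr_fun hP.2.1.eq) α).2 hsurj⟩
  · rintro ⟨P, ⟨hPa, hPi, hfg⟩, h⟩
    have hP := DFunLike.congr_fun hPi.eq
    exact HilbertModule.mPhiHatMinusPlus_of_surjective hPa hP hfg
      (hD.sub (HilbertModule.IsAdjointable.scalarOp α))
      ((HilbertModule.notMem_compressionDefectSpectrum_iff hP α).1 h)
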